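/- Let $\mathcal{C}$ be a small category with pullbacks, $J$ a Grothendieck topology on $\mathcal{C}$, and $j : \mathrm{Sh}(\mathcal{C},J) \to \mathrm{PSh}(\mathcal{C})$ the inclusion ($j^*$ is sheafification and $j_*$ the inclusion functor). A point $p$ of a topos $\mathcal{E}$ is a geometric morphism $\mathrm{Set}\to\mathcal{E}$, i.e. an adjunction $p^*\dashv p_*$ with $p^*:\mathcal{E}\to\mathrm{Set}$ preserving finite limits. A morphism $m : S \to T$ of $\mathrm{PSh}(\mathcal{C})$ is $j$-dense if $j_*j^*(m)$ is an isomorphism. Given a point $p$ of $\mathcal{E}$, an object $Z$, elements $x \neq y$ of $p^*(Z)$, a morphism $m:S\to T$ and $w\in p^*(T)$, an *improvement* of $p$ with respect to $(x,y,m,w)$ consists of a point $p'$ of $\mathcal{E}$, a natural transformation $n : p^*\Rightarrow p'^*$ and an element $v\in p'^*(S)$ such that $p'^*(m)(v)=n_T(w)$ and $n_Z(x)\neq n_Z(y)$. Let $\Phi$ be a class of small categories, regarded as index categories of limit diagrams. Suppose that $J$-covering sieves have final subdiagrams in $\Phi^{\mathrm{op}}$, in the following sense: every $J$-covering sieve on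 an object $C$ contains a $J$-covering sieve $S$ (possibly itself) for which there are $K\in\Phi$ and a final functor $K^{\mathrm{op}}\to S$, where $S$ is regarded as a full subcategory of $\mathcal{C}/C$ (for instance, $S$ has a final subcategory isomorphic to $K^{\mathrm{op}}$). **Proposition.** Let $p$ be a point of $\mathrm{PSh}(\mathcal{C})$ such that $p^*$ preserves limits of shape $K$ for every $K\in\Phi$, let $X$ be a $J$-sheaf on $\mathcal{C}$, and let $x\neq y$ in $p^*(j_*(X))$. Then for every $j$-dense monomorphism $m : S\rightarrowtail T$ of $\mathrm{PSh}(\mathcal{C})$ and every $w\in p^*(T)$ there is an improvement $(p',n,v)$ of $p$ with respect to $(x,y,m,w)$ such that $p'^*$ also preserves limits of shape $K$ for every $K\in\Phi$. -/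

import Mathlib

open CategoryTheory Limits Opposite

universe u w v₁ u₁

/-- A point `p` of a topos `E`: a geometric morphism from the topos of sets to `E`, i.e. an
adjunction `p^* ⊣ p_*` whose left adjoint `p^* : E ⥤ Set` preserves finite limits. -/
structure ToposPoint (E : Type u₁) [Category.{v₁} E] where
  /-- The inverse image functor `p^*`. -/
  inverseImage : E ⥤ Type w
  /-- The direct image functor `p_*`. -/
  directImage : Type w ⥤ E
  /-- The adjunction `p^* ⊣ p_*`. -/
  adj : inverseImage ⊣ directImage
  /-- `p^*` is left exact. -/
  lex : PreservesFiniteLimits inverseImage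

/-- A morphism `p ⟶ q` in the category `pt(E)` of points is a natural transformation
`p^* ⟶ q^*` between the inverse image functors. -/
abbrev ToposPoint.Hom {E : Type u₁} [Category.{v₁} E] (p q : ToposPoint.{w} E) :=
  p.inverseImage ⟶ q.inverseImage

/-- A class of limit diagrams is given by a class `Φ` of small index categories; this says that
`p^*` preserves the limits of all diagrams indexed by a member of `Φ`. -/
def ToposPoint.PreservesLimitsIn {E : Type u₁} [Category.{v₁} E] (p : ToposPoint.{w} E)
    (Φ : ObjectProperty Cat.{u, u}) : Prop :=
  ∀ K : Cat.{u, u}, Φ K → PreservesLimitsOfShape K p.inverseImage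

/-- An improvement of the point `p` with respect to `(x, y, m, w)`, where `x, y ∈ p^* Z`,
`m : S ⟶ T` and `w ∈ p^* T`: a point `p'` with a morphism `n : p' ⟶ p` of `pt(E)ᵒᵖ`
(that is, `p ⟶ p'` in `pt(E)`) and `v ∈ p'^* S` such that `m` sends `v` to the image of `w`
under `n`, while the images of `x` and `y` under `n` remain distinct. -/
structure Improvement {E : Type u₁} [Category.{v₁} E] (p : ToposPoint.{w} E) {Z S T : E}
    (x y : p.inverseImage.obj Z) (m : S ⟶ T) (w : p.inverseImage.obj T) where
  /-- The improved point `p'`. -/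
  point : ToposPoint.{w} E
  /-- The comparison morphism. -/
  n : p.Hom point
  /-- The lift of `w` along `m`. -/
  v : point.inverseImage.obj S
  lift : point.inverseImage.map m v = n.app T w
  distinct : n.app Z x ≠ n.app Z y

/-- A morphism of presheaves is `j`-dense, for the inclusion `j : Sh(C, J) ⟶ PSh(C)`, if
`j_* j^*` sends it to an isomorphism (`j^*` is sheafification, `j_*` the inclusion). -/
def IsDenseMorphism {C : Type u} [SmallCategory C] (J : GrothendieckTopology C)
    {S T : Cᵒᵖ ⥤ Type u} (m : S ⟶ T) : Prop :=
  IsIso ((presheafToSheaf J (Type u) ⋙ sheafToPresheaf J (Type u)).map m)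

/-- The `J`-covering sieves have final subdiagrams in `Φᵒᵖ`: every covering sieve on `X` contains
a covering sieve `S` (possibly itself) which, viewed as a full subcategory of `C / X`, admits a
final functor from the opposite of some `K` in `Φ` (for example, the inclusion of a final
subcategory that is isomorphic to `Kᵒᵖ`). -/
def HasFinalSubdiagrams {C : Type u} [SmallCategory C] (J : GrothendieckTopology C)
    (Φ : ObjectProperty Cat.{u, u}) : Prop :=
  ∀ ⦃X : C⦄, ∀ R ∈ J X, ∃ S ∈ J X, S ≤ R ∧
    ∃ K : Cat.{u, u}, Φ K ∧ ∃ F : (K : Type u)ᵒᵖ ⥤ S.arrows.category, F.Final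

/-! Write `P` for `p^*`. As `P` is cocontinuous, `w` comes from some `e ∈ P (yoneda c)` and `t ∈
T(c)`. The element `e` lifts the point `p` to the slice over `yoneda c`, which is presheaves on `C /
c`: the lifted functor `stalk P e` takes a presheaf, seen as an object over `yoneda c`, to the fibre
over `e` of its `P`-value. It preserves the colimits, finite limits and `Φ`-limits that `P`
preserves, and restricting to `C / c` and then taking the stalk gives back `P` (`stalkRestriction`).

For `d : C / c`, put `p'^* Z = stalk (b ↦ Z (d ⨯ b))`. Precomposition with `d ⨯ -` preserves all
limits and colimits, so this is again a point preserving `Φ`-limits; second projections give `n :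
p^* ⟶ p'^*`. Density makes the sieve of arrows along which `t` lifts through `m` covering; for `d`
in it, a lift `s ∈ S(d)` restricted along first projections gives `v`.

It remains to choose `d` so that `x` and `y` stay distinct. Take a covering subsieve with a final
functor `F` from `Kᵒᵖ`. Since `X` is separated, its restriction to `C / c` embeds in the limit over
`K` of the presheaves `b ↦ X (F k ⨯ b)` (`mono_lift_precompProdCone`). The stalk preserves this
limit and this monomorphism, so some `d = F k` separates `x` from `y` (`exists_toPrecompProd_ne`).
-/

namespace OverPresheaf

/-! ### Presheaves on `C / c` as presheaves over `yoneda c` -/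

variable {C : Type u} [SmallCategory C] {c : C}

/-- The value at `E` of the total presheaf of a presheaf `W` on `Over c`: pairs of a morphism
`g : E ⟶ c` and an element of `W` at `g`. -/
structure TotalObj (W : (Over c)ᵒᵖ ⥤ Type u) (E : C) : Type u where
  /-- The structure morphism. -/
  hom : E ⟶ c
  /-- The element over it. -/
  val : W.obj (op (Over.mk hom))

/-- Restriction along a lift of the identity replaces transport along the equality of structure
morphisms. -/
lemma TotalObj.ext_of_map {W : (Over c)ᵒᵖ ⥤ Type u} {E : C} {a b : TotalObj W E}
    (h : a.hom = b.hom)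
    (hv : W.map (Over.homMk (𝟙 E) (by simp [h]) : Over.mk a.hom ⟶ Over.mk b.hom).op b.val = a.val) :
    a = b := by
  obtain ⟨g, z⟩ := a
  obtain ⟨g', z'⟩ := b
  obtain rfl : g = g' := h
  have e : (Over.homMk (𝟙 E) (by simp) : Over.mk g ⟶ Over.mk g) = 𝟙 _ := by ext; simp
  simp only [e] at hv
  congr 1
  simpa using hv.symm

/-- Restriction of elements of the total presheaf. -/
def TotalObj.restrict {W : (Over c)ᵒᵖ ⥤ Type u} {E E' : C} (h : E' ⟶ E) (a : TotalObj W E) :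
    TotalObj W E' where
  hom := h ≫ a.hom
  val := W.map (Over.homMk h (by simp) : Over.mk (h ≫ a.hom) ⟶ Over.mk a.hom).op a.val

lemma TotalObj.restrict_mk {W : (Over c)ᵒᵖ ⥤ Type u} {g g' : Over c} (h : g' ⟶ g)
    (z : W.obj (op g)) :
    TotalObj.restrict h.left (⟨g.hom, z⟩ : TotalObj W g.left) =
      (⟨g'.hom, W.map h.op z⟩ : TotalObj W g'.left) := by
  refine TotalObj.ext_of_map (Over.w h) ?_
  refine ((W.map_comp_apply _ _ z).symm).trans ?_
  refine congrArg (fun k : op g ⟶ op (Over.mk (h.left ≫ g.hom)) => W.map k z) ?_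
  apply Quiver.Hom.unop_inj
  ext
  exact Category.id_comp _

/-- The functor taking a presheaf on `Over c` to the domain of the corresponding object
over the presheaf represented by `c`. -/
def total (c : C) : ((Over c)ᵒᵖ ⥤ Type u) ⥤ (Cᵒᵖ ⥤ Type u) where
  obj W :=
    { obj := fun E => TotalObj W E.unop
      map := fun h => ↾(TotalObj.restrict h.unop)
      map_id := fun E => by
        ext a
        refine (TotalObj.restrict_mk (𝟙 (Over.mk a.hom)) a.val).trans ?_
        exact congrArg (TotalObj.mk a.hom) (W.map_id_apply _ a.val)
      map_comp := fun {E E' E''} f g => by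
        ext a
        refine TotalObj.ext_of_map (Category.assoc g.unop f.unop a.hom) ?_
        refine ((W.map_comp_apply _ _ _).symm.trans (W.map_comp_apply _ _ _).symm).trans ?_
        refine congrArg (fun k : op (Over.mk a.hom) ⟶ op (Over.mk ((g.unop ≫ f.unop) ≫ a.hom)) =>
          W.map k a.val) ?_
        apply Quiver.Hom.unop_inj
        ext
        change (𝟙 _ ≫ g.unop) ≫ f.unop = g.unop ≫ f.unop
        rw [Category.id_comp] }
  map φ :=
    { app := fun _ => ↾(fun a => ⟨a.hom, φ.app _ a.val⟩)
      naturality := fun E E' h => by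
        ext a
        exact congrArg (TotalObj.mk _) (NatTrans.naturality_apply φ _ _) }
  map_id := fun _ => rfl
  map_comp := fun φ ψ => rfl

/-- The projection from the total presheaf to the representable presheaf. -/
def totalProj (c : C) : total c ⟶ (Functor.const _).obj (yoneda.obj c) where
  app _ := { app := fun _ => ↾(fun a => a.hom), naturality := fun _ _ _ => rfl }
  naturality _ _ _ := rfl

/-- The restriction of presheaves on `C` to presheaves on `Over c`. -/
abbrev restriction (c : C) : (Cᵒᵖ ⥤ Type u) ⥤ ((Over c)ᵒᵖ ⥤ Type u) :=
  (Functor.whiskeringLeft _ _ _).obj (Over.forget c).op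

/-- The total presheaf functor is left adjoint to restriction. -/
def totalAdj (c : C) : total c ⊣ restriction c :=
  Adjunction.mkOfHomEquiv
    { homEquiv := fun W _ =>
        { toFun := fun φ =>
            { app := fun g => ↾(fun z => φ.app (op g.unop.left) ⟨g.unop.hom, z⟩)
              naturality := fun g g' h => by
                ext z
                exact (congrArg (φ.app (op g'.unop.left))
                  (TotalObj.restrict_mk h.unop z).symm).trans (NatTrans.naturality_apply φ
                    h.unop.left.op (⟨g.unop.hom, z⟩ : TotalObj W _)) }
          invFun := fun ψ =>
            { app := fun _ => ↾(fun a => ψ.app _ a.val)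
              naturality := fun E E' h => by
                ext a
                exact NatTrans.naturality_apply ψ _ a.val }
          left_inv := fun φ => rfl
          right_inv := fun ψ => rfl }
      homEquiv_naturality_left_symm := fun _ _ => rfl
      homEquiv_naturality_right := fun _ _ => rfl }

instance (c : C) : (total c).IsLeftAdjoint := (totalAdj c).isLeftAdjoint

/-! ### The lift of `P` to the slice determined by `e` -/

variable (P : (Cᵒᵖ ⥤ Type u) ⥤ Type u) (e : P.obj (yoneda.obj c))

/-- The fibre over `e` of the values of `P` at total presheaves. -/
def stalk : ((Over c)ᵒᵖ ⥤ Type u) ⥤ Type u where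
  obj W := { q : P.obj ((total c).obj W) // P.map ((totalProj c).app W) q = e }
  map {W W'} φ := ↾(fun q => ⟨P.map ((total c).map φ) q.1, by
    rw [← P.map_comp_apply, (totalProj c).naturality φ]
    exact q.2⟩)
  map_id W := by
    ext q
    change P.map ((total c).map (𝟙 W)) q.1 = q.1
    simp
  map_comp f g := by
    ext q
    change P.map ((total c).map (f ≫ g)) q.1 = P.map _ (P.map _ q.1)
    simp

lemma totalProj_map {W W' : (Over c)ᵒᵖ ⥤ Type u} (φ : W ⟶ W') (q : P.obj ((total c).obj W)) :
    P.map ((totalProj c).app W') (P.map ((total c).map φ) q) = P.map ((totalProj c).app W) q := by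
  rw [← P.map_comp_apply, (totalProj c).naturality φ]
  rfl

/-! ### Colimits of stalks -/

section Colimits

variable {J : Type*} [Category* J] {D : J ⥤ (Over c)ᵒᵖ ⥤ Type u}

/-- A cocone over the stalks, extended to a cocone of partially defined maps. -/
def partCocone (t : Cocone (D ⋙ stalk P e)) : Cocone (D ⋙ total c ⋙ P) where
  -- `Part` classifies partial maps: a map defined only on the fibre over `e` becomes a total one,
  -- to which the colimit property of `P` applies.
  pt := Part t.pt
  ι :=
    { app := fun j => ↾(fun q => ⟨P.map ((totalProj c).app (D.obj j)) q = e,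
        fun h => t.ι.app j ⟨q, h⟩⟩)
      naturality := fun j j' f => by
        ext q
        refine Part.ext' ?_ ?_
        · exact iff_of_eq (congrArg (· = e) (totalProj_map P (D.map f) q))
        · intro h₁ h₂
          exact ConcreteCategory.congr_hom (t.w f) ⟨q, h₂⟩ }

/-- An element of the colimit has a representative at some stage, and the projections to `yoneda c`
are compatible, so the representative also lies over `e`. -/
lemma partCocone_dom {s : Cocone D} (hs : IsColimit ((total c ⋙ P).mapCocone s))
    (t : Cocone (D ⋙ stalk P e)) (q : (stalk P e).obj s.pt) :
    (hs.desc (partCocone P e t) q.1).Dom := by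
  obtain ⟨j, z, hz⟩ := Types.jointly_surjective_of_isColimit hs q.1
  have h := ConcreteCategory.congr_hom (hs.fac (partCocone P e t) j) z
  have h' : hs.desc (partCocone P e t) q.1 = (partCocone P e t).ι.app j z := by
    rw [← hz]; exact h
  rw [h']
  change P.map ((totalProj c).app (D.obj j)) z = e
  rw [← q.2, ← hz]
  exact (totalProj_map P (s.ι.app j) z).symm

/-- Stalks commute with colimits preserved by `P`. -/
def isColimitStalk {s : Cocone D} (hs : IsColimit ((total c ⋙ P).mapCocone s)) :
    IsColimit ((stalk P e).mapCocone s) where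
  desc t := ↾(fun q => (hs.desc (partCocone P e t) q.1).get (partCocone_dom P e hs t q))
  fac t j := by
    ext q
    have h := ConcreteCategory.congr_hom (hs.fac (partCocone P e t) j) q.1
    apply Part.get_eq_of_mem
    change Membership.mem (α := t.pt) (γ := Part t.pt) (hs.desc (partCocone P e t)
      (P.map ((total c).map (s.ι.app j)) q.1)) (t.ι.app j q)
    rw [show hs.desc (partCocone P e t) (P.map ((total c).map (s.ι.app j)) q.1) =
      (partCocone P e t).ι.app j q.1 from h]
    exact ⟨q.2, rfl⟩
  uniq t f hf := by
    ext q
    obtain ⟨j, z, hz⟩ := Types.jointly_surjective_of_isColimit hs q.1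
    have hz' : P.map ((totalProj c).app (D.obj j)) z = e := by
      rw [← q.2, ← hz]
      exact (totalProj_map P (s.ι.app j) z).symm
    obtain rfl : (stalk P e).map (s.ι.app j) ⟨z, hz'⟩ = q := Subtype.ext hz
    refine (ConcreteCategory.congr_hom (hf j) ⟨z, hz'⟩).trans (Eq.symm ?_)
    apply Part.get_eq_of_mem
    have : hs.desc (partCocone P e t) ((stalk P e).map (s.ι.app j) ⟨z, hz'⟩).1 =
      (partCocone P e t).ι.app j z := ConcreteCategory.congr_hom (hs.fac (partCocone P e t) j) z
    rw [this]
    exact ⟨hz', rfl⟩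

instance stalk_preservesColimitsOfShape [PreservesColimitsOfShape J P] :
    PreservesColimitsOfShape J (stalk P e) where
  preservesColimit := ⟨fun hs => ⟨isColimitStalk P e (isColimitOfPreserves (total c ⋙ P) hs)⟩⟩

end Colimits

/-! ### Limits of stalks -/

section Limits

variable {J : Type*} [Category* J] {D : J ⥤ (Over c)ᵒᵖ ⥤ Type u}

/-- The cone with point the representable presheaf over the constant diagram. -/
abbrev constCone (J : Type*) [Category* J] (c : C) :
    Cone ((Functor.const J).obj (yoneda.obj c)) where
  pt := yoneda.obj c
  π := 𝟙 _

/-- The cone over the constant diagram obtained by projecting a cone over total presheaves. -/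
abbrev projCone (L : Cone (D ⋙ total c)) : Cone ((Functor.const J).obj (yoneda.obj c)) where
  pt := L.pt
  π :=
    { app := fun j => L.π.app j ≫ (totalProj c).app (D.obj j)
      naturality := fun i j f => by
        have h := (totalProj c).naturality (D.map f)
        have h' := L.w f
        dsimp at h h' ⊢
        rw [Category.id_comp, Category.comp_id, ← h', Category.assoc, h, Category.comp_id] }

lemma limit_ext_of_isLimit {F : J ⥤ Type u} {t : Cone F} (ht : IsLimit t) {a b : t.pt}
    (h : ∀ j, t.π.app j a = t.π.app j b) : a = b :=
  (Types.isLimitEquivSections ht).injective (Subtype.ext (funext h))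

/-- The total presheaf functor need not preserve disconnected limits: a limit of total presheaves
allows different structure morphisms at different indices. Pulling back along the diagonal from
`yoneda c` forces them to agree. -/
lemma isPullback_total [HasLimitsOfShape J (Type u)]
    {s : Cone D} (hs : IsLimit s) {L : Cone (D ⋙ total c)} (hL : IsLimit L)
    {M : Cone ((Functor.const J).obj (yoneda.obj c))} (hM : IsLimit M) :
    IsPullback (hL.lift ((total c).mapCone s)) ((totalProj c).app s.pt)
      (hM.lift (projCone L)) (hM.lift (constCone J c)) := by
  refine IsPullback.of_forall_isPullback_app fun E => ?_
  have hsE (g : unop E ⟶ c) := isLimitOfPreserves ((evaluation _ _).obj (op (Over.mk g))) hs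
  have hLE := isLimitOfPreserves ((evaluation _ _).obj E) hL
  have hLπ (j : J) (a : TotalObj s.pt E.unop) :
      (L.π.app j).app E ((hL.lift ((total c).mapCone s)).app E a) =
        (⟨a.hom, (s.π.app j).app _ a.val⟩ : TotalObj (D.obj j) E.unop) :=
    ConcreteCategory.congr_hom (NatTrans.congr_app (hL.fac ((total c).mapCone s) j) E) a
  rw [Types.isPullback_iff]
  refine ⟨?_, ?_, ?_⟩
  · rw [← NatTrans.comp_app, ← NatTrans.comp_app]
    refine NatTrans.congr_app (hM.hom_ext fun j => ?_) E
    rw [Category.assoc, Category.assoc, hM.fac, hM.fac]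
    change hL.lift ((total c).mapCone s) ≫ L.π.app j ≫ _ = _ ≫ 𝟙 _
    rw [hL.fac_assoc, Category.comp_id]
    exact (totalProj c).naturality (s.π.app j)
  · rintro ⟨g, a⟩ ⟨g', b⟩ ⟨h₁, h₂⟩
    obtain rfl : g = g' := h₂
    congr 1
    refine limit_ext_of_isLimit (hsE g) fun j => ?_
    have h := congrArg ((L.π.app j).app E) h₁
    erw [hLπ j ⟨g, a⟩, hLπ j ⟨g, b⟩] at h
    exact eq_of_heq (TotalObj.mk.inj h).2
  · intro x g h
    -- All components of `x` lie over the same `g`, so they form a compatible family in the values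
    -- of `D` at `g`.
    have hg (j : J) : ∃ z, (L.π.app j).app E x = (⟨g, z⟩ : TotalObj (D.obj j) E.unop) := by
      have h₁ := ConcreteCategory.congr_hom (NatTrans.congr_app (hM.fac (projCone L) j) E) x
      have h₂ := ConcreteCategory.congr_hom (NatTrans.congr_app (hM.fac (constCone J c) j) E) g
      have h₃ : ((L.π.app j).app E x : TotalObj (D.obj j) E.unop).hom = g :=
        h₁.symm.trans ((congrArg ((M.π.app j).app E) h).trans h₂)
      generalize (L.π.app j).app E x = y at h₃ ⊢
      obtain ⟨g', z⟩ := y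
      obtain rfl : g' = g := h₃
      exact ⟨z, rfl⟩
    choose z hz using hg
    obtain ⟨a, ha, -⟩ := (Types.isLimit_iff _).1 ⟨hsE g⟩ z (by
      intro i j f
      have h₁ := ConcreteCategory.congr_hom (NatTrans.congr_app (L.w f) E) x
      have h₂ : ((D ⋙ total c).map f).app E ((L.π.app i).app E x) = (L.π.app j).app E x := h₁
      rw [hz i, hz j] at h₂
      exact eq_of_heq (TotalObj.mk.inj h₂).2)
    refine ⟨(⟨g, a⟩ : TotalObj s.pt E.unop), ?_, rfl⟩
    refine limit_ext_of_isLimit hLE fun j => ?_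
    refine (hLπ j ⟨g, a⟩).trans (Eq.trans ?_ (hz j).symm)
    exact congrArg (TotalObj.mk g) (ha j)

/-- `P` preserves the pullback square of `isPullback_total` and the two limits in it; the fibre over
`e` is then the set of compatible families all of whose members lie over `e`. -/
lemma stalk_preservesLimitsOfShape [HasLimitsOfShape J (Type u)] [PreservesLimitsOfShape J P]
    [PreservesLimitsOfShape WalkingCospan P] :
    PreservesLimitsOfShape J (stalk P e) where
  preservesLimit {D} := ⟨fun {s} hs => by
    have hL := limit.isLimit (D ⋙ total c)
    have hM := limit.isLimit ((Functor.const J).obj (yoneda.obj c))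
    have sq := (isPullback_total hs hL hM).map P
    have hPL := isLimitOfPreserves P hL
    have hPM := isLimitOfPreserves P hM
    have hπ (j : J) (q : P.obj ((total c).obj s.pt)) :
        P.map ((limit.cone (D ⋙ total c)).π.app j) (P.map (hL.lift ((total c).mapCone s)) q) =
          P.map ((total c).map (s.π.app j)) q := by
      rw [← P.map_comp_apply, hL.fac]
      rfl
    refine (Types.isLimit_iff _).2 fun σ hσ => ?_
    obtain ⟨x, hx, -⟩ := (Types.isLimit_iff _).1 ⟨hPL⟩ (fun j => (σ j).1)
      (fun f => congrArg Subtype.val (hσ f))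
    obtain ⟨q, hq, hqe⟩ := Types.exists_of_isPullback sq x e (by
      refine limit_ext_of_isLimit hPM fun j => ?_
      change P.map _ (P.map _ _) = P.map _ (P.map _ _)
      rw [← P.map_comp_apply, ← P.map_comp_apply, hM.fac, hM.fac]
      change P.map (_ ≫ _) x = P.map (𝟙 _) e
      rw [P.map_comp_apply, P.map_id_apply]
      refine Eq.trans ?_ (σ j).2
      exact congrArg _ (hx j))
    refine ⟨⟨q, hqe⟩, fun j => Subtype.ext ?_, fun q' hq' => Subtype.ext ?_⟩
    · refine Eq.trans ?_ (hx j)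
      rw [← hq]
      exact (hπ j q).symm
    · refine Types.ext_of_isPullback sq ?_ (q'.2.trans hqe.symm)
      rw [hq]
      refine limit_ext_of_isLimit hPL fun j => ?_
      refine (hπ j q'.1).trans (Eq.trans ?_ (hx j).symm)
      exact congrArg Subtype.val (hq' j)⟩

end Limits

/-! ### Recovering `P` from stalks of restricted presheaves -/

/-- The constant presheaf with value a point. -/
abbrev point (B : Type*) [Category* B] : Bᵒᵖ ⥤ Type u := (Functor.const _).obj PUnit.{u + 1}

/-- The morphism to the constant presheaf with value a point. -/
def toPoint {B : Type*} [Category* B] (Z : Bᵒᵖ ⥤ Type u) : Z ⟶ point.{u} B where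
  app _ := ↾(fun _ => PUnit.unit)

/-- This exhibits the total presheaf of the restriction of `Z` as the product of `Z` and `yoneda c`,
so its fibre over `e` after applying a left exact `P` is `P.obj Z`. -/
lemma isPullback_counit (Z : Cᵒᵖ ⥤ Type u) :
    IsPullback ((totalAdj c).counit.app Z) ((totalProj c).app ((restriction c).obj Z))
      (toPoint Z) (toPoint _) := by
  refine IsPullback.of_forall_isPullback_app fun E => ?_
  rw [Types.isPullback_iff]
  refine ⟨rfl, ?_, fun z g _ => ⟨(⟨g, z⟩ : TotalObj _ E.unop), rfl, rfl⟩⟩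
  rintro ⟨g, a⟩ ⟨g', b⟩ ⟨h₁, h₂⟩
  obtain rfl : g = g' := h₂
  obtain rfl : a = b := h₁
  rfl

lemma subsingleton_obj_point [PreservesFiniteLimits P] : Subsingleton (P.obj (point C)) := by
  have h : IsTerminal (point.{u} C) :=
    IsTerminal.ofUniqueHom toPoint fun _ _ => rfl
  have h' := h.isTerminalObj P
  exact ⟨fun a b => ConcreteCategory.congr_hom (h'.hom_ext (↾(fun _ : PUnit => a))
    (↾(fun _ : PUnit => b))) PUnit.unit⟩

/-- The comparison from the stalks of restricted presheaves. -/
def stalkRestriction : restriction c ⋙ stalk P e ⟶ P where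
  app Z := ↾(fun q => P.map ((totalAdj c).counit.app Z) q.1)
  naturality Z Z' f := by
    ext q
    have h := (totalAdj c).counit.naturality f
    change P.map _ (P.map _ q.1) = P.map _ (P.map _ q.1)
    rw [← P.map_comp_apply, ← P.map_comp_apply]
    exact ConcreteCategory.congr_hom (congrArg P.map h) q.1

instance [PreservesFiniteLimits P] : IsIso (stalkRestriction P e) := by
  rw [NatTrans.isIso_iff_isIso_app]
  intro Z
  rw [isIso_iff_bijective]
  have sq := (isPullback_counit (c := c) Z).map P
  have := subsingleton_obj_point P
  constructor
  · intro q q' h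
    exact Subtype.ext (Types.ext_of_isPullback sq h (q.2.trans q'.2.symm))
  · intro z
    obtain ⟨q, hq, hqe⟩ := Types.exists_of_isPullback sq z e (Subsingleton.elim _ _)
    exact ⟨⟨q, hqe⟩, hq⟩

/-- The morphism from the representable presheaf to the total presheaf of a point. -/
def yonedaToTotal (c : C) : yoneda.obj c ⟶ (total c).obj (point (Over c)) where
  app _ := ↾(fun g => ⟨g, PUnit.unit⟩)
  naturality _ _ _ := rfl

/-- The element of the stalk given by a global section. -/
def stalkSection {W : (Over c)ᵒᵖ ⥤ Type u} (ψ : point (Over c) ⟶ W) : (stalk P e).obj W :=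
  (stalk P e).map ψ ⟨P.map (yonedaToTotal c) e, by
    rw [← P.map_comp_apply]
    exact P.map_id_apply _ e⟩

lemma stalk_map_stalkSection {W W' : (Over c)ᵒᵖ ⥤ Type u} (ψ : point (Over c) ⟶ W) (φ : W ⟶ W') :
    (stalk P e).map φ (stalkSection P e ψ) = stalkSection P e (ψ ≫ φ) :=
  ((stalk P e).map_comp_apply _ _ _).symm

/-- The global section of the restriction of `Z` given by an element of `Z` at `c`. -/
def sectionOfElement {Z : Cᵒᵖ ⥤ Type u} (t : Z.obj (op c)) :
    point (Over c) ⟶ (restriction c).obj Z where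
  app b := ↾(fun _ => Z.map b.unop.hom.op t)
  naturality b b' f := by
    ext
    change Z.map b'.unop.hom.op t = Z.map f.unop.left.op (Z.map b.unop.hom.op t)
    rw [← Z.map_comp_apply, ← op_comp, Over.w]

lemma stalkRestriction_stalkSection {Z : Cᵒᵖ ⥤ Type u} (t : Z.obj (op c)) :
    (stalkRestriction P e).app Z (stalkSection P e (sectionOfElement t)) =
      P.map (yonedaEquiv.symm t) e := by
  change P.map _ (P.map _ (P.map _ e)) = _
  rw [← P.map_comp_apply, ← P.map_comp_apply]
  rfl

/-! ### The improved point attached to an object `d` of `C / c` -/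

section Products

variable [HasBinaryProducts (Over c)] (d : Over c)

/-- Precomposition with the product with `d`. -/
noncomputable abbrev precompProd : ((Over c)ᵒᵖ ⥤ Type u) ⥤ ((Over c)ᵒᵖ ⥤ Type u) :=
  (Functor.whiskeringLeft _ _ _).obj (prod.functor.obj d).op

/-- Restriction along the second projections. -/
noncomputable def toPrecompProd : 𝟭 _ ⟶ precompProd d where
  app W :=
    { app := fun b => W.map (prod.snd (X := d) (Y := b.unop)).op
      naturality := fun b b' f => by
        refine (W.map_comp _ _).symm.trans (Eq.trans ?_ (W.map_comp _ _))
        exact congrArg (fun k => W.map k.op) (prod.map_snd (𝟙 d) f.unop).symm }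
  naturality W W' φ := by
    ext b z
    exact (NatTrans.naturality_apply φ (prod.snd (X := d) (Y := b.unop)).op z).symm

/-- The inverse image functor of the improved point. -/
noncomputable abbrev productStalk : (Cᵒᵖ ⥤ Type u) ⥤ Type u :=
  restriction c ⋙ precompProd d ⋙ stalk P e

lemma productStalk_preservesLimitsOfShape (J : Type*) [Category* J] [HasLimitsOfShape J (Type u)]
    [PreservesLimitsOfShape J P] [PreservesLimitsOfShape WalkingCospan P] :
    PreservesLimitsOfShape J (productStalk P e d) := by
  have := stalk_preservesLimitsOfShape (J := J) P e
  infer_instance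

instance productStalk_isLeftAdjoint [PreservesColimitsOfSize.{u, u} P] :
    (productStalk P e d).IsLeftAdjoint := by
  have : PreservesColimitsOfSize.{u, u} (productStalk P e d) := ⟨inferInstance⟩
  exact Presheaf.isLeftAdjoint_of_preservesColimits.{u} _

/-- The comparison with the improved point. -/
noncomputable def toProductStalk [PreservesFiniteLimits P] : P ⟶ productStalk P e d :=
  inv (stalkRestriction P e) ≫
    Functor.whiskerLeft (restriction c) (Functor.whiskerRight (toPrecompProd d) (stalk P e))

lemma toProductStalk_apply [PreservesFiniteLimits P] {Z : Cᵒᵖ ⥤ Type u}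
    (q : (stalk P e).obj ((restriction c).obj Z)) :
    (toProductStalk P e d).app Z ((stalkRestriction P e).app Z q) =
      (stalk P e).map ((toPrecompProd d).app ((restriction c).obj Z)) q := by
  have h : stalkRestriction P e ≫ toProductStalk P e d = _ := IsIso.hom_inv_id_assoc _ _
  exact ConcreteCategory.congr_hom (NatTrans.congr_app h Z) q

/-- The global section given by an element over `d`. -/
noncomputable def sectionOfElementProd {Z : Cᵒᵖ ⥤ Type u} (s : Z.obj (op d.left)) :
    point (Over c) ⟶ (precompProd d).obj ((restriction c).obj Z) where
  app b := ↾(fun _ => Z.map (prod.fst (X := d) (Y := b.unop)).left.op s)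
  naturality b b' f := by
    ext
    change Z.map _ s = Z.map (prod.map (𝟙 d) f.unop).left.op (Z.map _ s)
    rw [← Z.map_comp_apply, ← op_comp, ← Over.comp_left, prod.map_fst, Category.comp_id]

/-- Both composites `d ⨯ b ⟶ c`, through `d` and through `b`, are the structure morphism of the
product. -/
lemma sectionOfElementProd_comp {Z Z' : Cᵒᵖ ⥤ Type u} (φ : Z ⟶ Z') (s : Z.obj (op d.left))
    (t : Z'.obj (op c)) (h : φ.app _ s = Z'.map d.hom.op t) :
    sectionOfElementProd d s ≫ (precompProd d).map ((restriction c).map φ) =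
      sectionOfElement t ≫ (toPrecompProd d).app _ := by
  ext b
  change φ.app _ (Z.map _ s) = Z'.map (prod.snd (X := d) (Y := b.unop)).left.op (Z'.map _ t)
  rw [NatTrans.naturality_apply, h, ← Z'.map_comp_apply, ← Z'.map_comp_apply, ← op_comp,
    ← op_comp, Over.w, Over.w]

section Diagram

variable {K : Type u} [SmallCategory K] (d : Kᵒᵖ ⥤ Over c) (W : (Over c)ᵒᵖ ⥤ Type u)

/-- The diagram of the presheaves `b ↦ W (d k ⨯ b)`. -/
noncomputable def precompProdDiagram : K ⥤ (Over c)ᵒᵖ ⥤ Type u where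
  obj k := (precompProd (d.obj (op k))).obj W
  map f := Functor.whiskerRight (NatTrans.op (prod.functor.map (d.map f.op))) W
  map_id k := by
    ext b z
    simp
  map_comp f g := by
    ext b z
    simp

/-- The cone given by the second projections. -/
noncomputable def precompProdCone : Cone (precompProdDiagram d W) where
  pt := W
  π :=
    { app := fun k => (toPrecompProd (d.obj (op k))).app W
      naturality := fun k k' f => by
        ext b z
        change W.map _ z = W.map (prod.map (d.map f.op) (𝟙 b.unop)).op (W.map _ z)
        rw [← W.map_comp_apply, ← op_comp, prod.map_snd, Category.comp_id] }

lemma exists_toPrecompProd_ne [PreservesLimitsOfShape K P] [PreservesFiniteLimits P]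
    [Mono (limit.lift _ (precompProdCone d W))] {x y : (stalk P e).obj W} (hxy : x ≠ y) :
    ∃ k, (stalk P e).map ((toPrecompProd (d.obj k)).app W) x ≠
      (stalk P e).map ((toPrecompProd (d.obj k)).app W) y := by
  have := stalk_preservesLimitsOfShape (J := K) P e
  -- Preserving pullbacks makes the stalk preserve monomorphisms.
  have := stalk_preservesLimitsOfShape (J := WalkingCospan) P e
  by_contra! h
  refine hxy ((mono_iff_injective ((stalk P e).map (limit.lift _ (precompProdCone d W)))).1
    inferInstance ?_)
  refine limit_ext_of_isLimit (isLimitOfPreserves (stalk P e) (limit.isLimit _)) fun k => ?_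
  have hl : limit.lift _ (precompProdCone d W) ≫ limit.π _ k =
    (toPrecompProd (d.obj (op k))).app W := limit.lift_π _ _
  have key (z : (stalk P e).obj W) :
      (stalk P e).map (limit.π (precompProdDiagram d W) k)
        ((stalk P e).map (limit.lift _ (precompProdCone d W)) z) =
      (stalk P e).map ((toPrecompProd (d.obj (op k))).app W) z := by
    rw [← hl]
    exact ((stalk P e).map_comp_apply _ _ z).symm
  exact (key x).trans ((h (op k)).trans (key y).symm)

end Diagram

/-- Each arrow of the sieve pulled back to `b` factors through some projection `F k ⨯ b ⟶ b`, so
sections agreeing along all these projections agree on a cover. -/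
lemma mono_lift_precompProdCone {K : Type u} [SmallCategory K] (J : GrothendieckTopology C)
    {X : Cᵒᵖ ⥤ Type u} (hX : Presieve.IsSheaf J X) {S : Sieve c} (hS : S ∈ J c)
    (F : Kᵒᵖ ⥤ S.arrows.category) [F.Final] :
    Mono (limit.lift _ (precompProdCone (F ⋙ ObjectProperty.ι _) ((restriction c).obj X))) := by
  rw [NatTrans.mono_iff_mono_app]
  intro b
  rw [mono_iff_injective]
  intro x y hxy
  refine (hX (S.pullback b.unop.hom) (J.pullback_stable _ hS)).isSeparatedFor.ext fun E h hE => ?_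
  -- Finality enters only through this: each member of the sieve maps over `c` to some `F k`.
  obtain ⟨k⟩ : Nonempty (StructuredArrow (Presieve.categoryMk S.arrows _ hE) F) := inferInstance
  have hk := congrArg ((limit.π (precompProdDiagram _ _) k.right.unop).app b) hxy
  have hlift (z : X.obj (op b.unop.left)) :
      (limit.π (precompProdDiagram (F ⋙ ObjectProperty.ι _) ((restriction c).obj X))
        k.right.unop).app b
        ((limit.lift _ (precompProdCone (F ⋙ ObjectProperty.ι _) ((restriction c).obj X))).app b z)
        = X.map (prod.snd (X := (F.obj k.right).obj) (Y := b.unop)).left.op z :=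
    ConcreteCategory.congr_hom (NatTrans.congr_app (limit.lift_π
      (precompProdCone (F ⋙ ObjectProperty.ι _) ((restriction c).obj X)) k.right.unop) b) z
  let φ : Over.mk (h ≫ b.unop.hom) ⟶ (F.obj k.right).obj ⨯ b.unop :=
    prod.lift k.hom.hom (Over.homMk h rfl)
  have hφ : h = φ.left ≫ (prod.snd (X := (F.obj k.right).obj) (Y := b.unop)).left := by
    rw [← Over.comp_left, prod.lift_snd]
    rfl
  have hsnd := (hlift x).symm.trans (hk.trans (hlift y))
  rw [hφ, op_comp]
  exact (X.map_comp_apply _ _ x).trans ((congrArg (X.map φ.left.op) hsnd).trans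
    (X.map_comp_apply _ _ y).symm)

end Products

/-! ### Reduction to representables and the conclusion -/

lemma exists_map_yoneda_eq [PreservesColimitsOfSize.{u, u} P] {T : Cᵒᵖ ⥤ Type u} (w : P.obj T) :
    ∃ (c : C) (e : P.obj (yoneda.obj c)) (t : T.obj (op c)), P.map (yonedaEquiv.symm t) e = w := by
  obtain ⟨⟨⟨⟨c⟩, t⟩⟩, e, he⟩ := Types.jointly_surjective_of_isColimit
    (isColimitOfPreserves P (Presheaf.colimitOfRepresentable.{u} T)) w
  let i : uliftYoneda.{u}.obj c ⟶ yoneda.obj c :=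
    { app := fun _ => ↾ULift.down, naturality := fun _ _ _ => rfl }
  exact ⟨c, P.map i e, t, (P.map_comp_apply i (yonedaEquiv.symm t) e).symm.trans he⟩

end OverPresheaf

lemma IsDenseMorphism.isLocallySurjective {C : Type u} [SmallCategory C]
    {J : GrothendieckTopology C} {S T : Cᵒᵖ ⥤ Type u} {m : S ⟶ T} (hm : IsDenseMorphism J m) :
    Presheaf.IsLocallySurjective J m := by
  have : IsIso ((sheafToPresheaf J (Type u)).map ((presheafToSheaf J (Type u)).map m)) := hm
  exact ((J.W_iff m).2 (isIso_of_reflects_iso _ (sheafToPresheaf J (Type u)))).isLocallySurjective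

open OverPresheaf in
theorem proposition3p2 {C : Type u} [SmallCategory C] [HasPullbacks C]
    (J : GrothendieckTopology C) (Φ : ObjectProperty Cat.{u, u})
    (hΦ : HasFinalSubdiagrams J Φ)
    (p : ToposPoint.{u} (Cᵒᵖ ⥤ Type u)) (hp : p.PreservesLimitsIn Φ)
    (X : Sheaf J (Type u))
    (x y : p.inverseImage.obj ((sheafToPresheaf J (Type u)).obj X)) (hxy : x ≠ y)
    {S T : Cᵒᵖ ⥤ Type u} (m : S ⟶ T) [Mono m] (hm : IsDenseMorphism J m)
    (w : p.inverseImage.obj T) :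
    ∃ I : Improvement p x y m w, I.point.PreservesLimitsIn Φ := by
  have := hm.isLocallySurjective
  have := p.lex
  have : PreservesColimitsOfSize.{u, u} p.inverseImage := p.adj.leftAdjoint_preservesColimits
  obtain ⟨c, e, t, rfl⟩ := exists_map_yoneda_eq p.inverseImage w
  have : HasBinaryProducts (Over c) := Over.ConstructProducts.over_binaryProduct_of_pullback
  -- The sieve refined here consists of the arrows along which `t` lifts through `m`, so every `F k`
  -- supplies a lift.
  obtain ⟨R, hR, hRm, K, hK, F, hF⟩ := hΦ (X := c) _ (Presheaf.imageSieve_mem J m (U := op c) t)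
  have := hp K hK
  have := mono_lift_precompProdCone J (X := (sheafToPresheaf J _).obj X)
    ((isSheaf_iff_isSheaf_of_type J _).1 X.property) hR F
  have hα (Z : Cᵒᵖ ⥤ Type u) :=
    (isIso_iff_bijective ((stalkRestriction p.inverseImage e).app Z)).1 inferInstance
  obtain ⟨x, rfl⟩ := (hα _).2 x
  obtain ⟨y, rfl⟩ := (hα _).2 y
  -- Every `F k` would lift `w`; the index is chosen to keep `x` and `y` apart.
  obtain ⟨k, hk⟩ := exists_toPrecompProd_ne p.inverseImage e (F ⋙ ObjectProperty.ι _) _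
    (fun h => hxy (congrArg _ h) : x ≠ y)
  let d : Over c := (F.obj k).obj
  obtain ⟨s, hs⟩ : ∃ s, m.app (op d.left) s = T.map d.hom.op t := hRm _ (F.obj k).property
  refine ⟨
    { point :=
        { inverseImage := productStalk p.inverseImage e d
          directImage := (productStalk p.inverseImage e d).rightAdjoint
          adj := Adjunction.ofIsLeftAdjoint _
          lex := ⟨fun L _ _ => productStalk_preservesLimitsOfShape _ e d L⟩ }
      n := toProductStalk p.inverseImage e d
      v := stalkSection p.inverseImage e (sectionOfElementProd d s)
      lift := ?_
      distinct := ?_ }, fun L hL => ?_⟩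
  · rw [← stalkRestriction_stalkSection, toProductStalk_apply, stalk_map_stalkSection]
    exact (stalk_map_stalkSection _ _ _ _).trans
      (congrArg (stalkSection p.inverseImage e) (sectionOfElementProd_comp d m s t hs))
  · rw [toProductStalk_apply, toProductStalk_apply]
    exact hk
  · have := hp L hL
    exact productStalk_preservesLimitsOfShape _ e d L
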